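/- Consider sixteen point masses in $\mathbb{R}^3$ located at the vertices of two nested cubes: eight points $q_1,\dots,q_8$ are the vertices of a cube with center $p$ (the outer cube), and the other eight are $q_{j+8}=p+t\,(q_j-p)$, $j=1,\dots,8$ (the inner cube), so that $t\in(0,1)$ is the ratio of the inner edge to the outer edge. Each vertex of the outer cube carries the same mass $\mu_1\in\mathbb{R}$ and each vertex of the inner cube carries the same mass $\mu_2\in\mathbb{R}$, with $(\mu_1,\mu_2)\neq(0,0)$ (signed masses are allowed). The configuration, with masses $m_1=\dots=m_8=\mu_1$ and $m_9=\dots=m_{16}=\mu_2$, is called central if there is a constant $c\in\mathbb{R}$ such that $$\sum_{j\neq i} m_j\left(\frac{1}{|q_j-q_i|^3}-c\right)(q_j-q_i)=0\qquad\text{for } i=1,\dots,16 .$$ Theorem. There is a $\delta$ with $0<\delta<1$, independent of the cubes and of the masses, such that in every such central configuration the masses $\mu_1$ and $\mu_2$ are nonzero and have the same sign if $t\in(0,\delta)$, and are nonzero and have opposite signs if $t\in(\delta,1)$. -/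

import Mathlib

/-- The configuration `q` with (real, possibly signed) masses `m` is central: there is a real `c`
such that `∑_{j ≠ i} m_j (1 / |q_j - q_i|³ - c) (q_j - q_i) = 0` for every `i`. -/
def IsCentralConfiguration {ι : Type*} [Fintype ι] [DecidableEq ι] {d : ℕ}
    (q : ι → EuclideanSpace ℝ (Fin d)) (m : ι → ℝ) : Prop :=
  ∃ c : ℝ, ∀ i : ι,
    ∑ j ∈ Finset.univ.erase i,
      (m j * (1 / ‖q j - q i‖ ^ 3 - c)) • (q j - q i) = 0

/-- The eight vertices `(±1, ±1, ±1)` of the standard cube, indexed by their sign patterns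
(`true` for `1`, `false` for `-1`). -/
noncomputable def cubeVertex (s : Fin 3 → Bool) : EuclideanSpace ℝ (Fin 3) :=
  WithLp.toLp 2 fun k => if s k then 1 else -1

/-- The sixteen positions `q` are the vertices of two nested cubes, the outer cube being the
left summand and the inner cube the right one, with edge ratio `t` (inner to outer): the outer
cube is an arbitrary cube in space (center `p`, edge `2 * a`, orientation `R`), and the inner cube
is its image under the homothety of ratio `t` about its center. -/
def IsNestedCubes (t : ℝ)
    (q : (Fin 3 → Bool) ⊕ (Fin 3 → Bool) → EuclideanSpace ℝ (Fin 3)) : Prop :=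
  ∃ (p : EuclideanSpace ℝ (Fin 3)) (a : ℝ)
    (R : EuclideanSpace ℝ (Fin 3) ≃ₗᵢ[ℝ] EuclideanSpace ℝ (Fin 3)),
    0 < a ∧
    (∀ s, q (Sum.inl s) = p + a • R (cubeVertex s)) ∧
    (∀ s, q (Sum.inr s) = p + t • (q (Sum.inl s) - p))

/-- The masses on two nested cubes: `μ₁` at every outer vertex, `μ₂` at every inner vertex. -/
def cubeMasses (μ₁ μ₂ : ℝ) : (Fin 3 → Bool) ⊕ (Fin 3 → Bool) → ℝ :=
  Sum.elim (fun _ => μ₁) (fun _ => μ₂)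

/-! One force equation at an outer vertex and one at an inner vertex on the same ray, each projected
to one coordinate, suffice. Both are linear in `c`; eliminating `c` leaves `t² (t A + P(t)) μ₁ = (A
- G(t)) μ₂`, with `A`, `G`, `P` short for `cubeSelfAttraction`, `innerAttraction`, `outerPull`. The
left factor is positive on `(0, 1)` (`outerPull_add_pos`), so for masses not both zero `μ₂ ≠ 0`, and
`μ₁ μ₂` has the sign of `A - G(t)`. Since `G` is continuous and strictly increasing on `[0, 1)`,
vanishes at `0` and exceeds `A` near `1`, that sign changes exactly once, at the `δ` with `G(δ) =
A`. -/

/-- The function `u ↦ u³ (3 + b u) / (3 + 3 u² + 2 b u)^(3/2)`: up to a constant, the attraction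
exerted on a vertex of the outer cube by those vertices of the inner cube that make an angle of
cosine `-b / 3` with it, multiplied by the cube of the edge ratio `u`. -/
noncomputable def scaledAttraction (b u : ℝ) : ℝ :=
  u ^ 3 * (3 + b * u) / √(3 + 3 * u ^ 2 + 2 * b * u) ^ 3

/-- The self-attraction coefficient of the cube with vertices `(±1, ±1, ±1)`. -/
noncomputable def cubeSelfAttraction : ℝ := 2 / √4 ^ 3 + 4 / √8 ^ 3 + 2 / √12 ^ 3

/-- The cube of the edge ratio times the attraction of the inner cube on an outer vertex. -/
noncomputable def innerAttraction (u : ℝ) : ℝ :=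
  scaledAttraction (-3) u / 3 + scaledAttraction (-1) u + scaledAttraction 1 u +
    scaledAttraction 3 u / 3

/-- The pull (away from the center) of the outer cube on an inner vertex. -/
noncomputable def outerPull (u : ℝ) : ℝ :=
  (1 - u) / √(3 + 3 * u ^ 2 - 6 * u) ^ 3 + (1 - 3 * u) / √(3 + 3 * u ^ 2 - 2 * u) ^ 3 -
    (1 + 3 * u) / √(3 + 3 * u ^ 2 + 2 * u) ^ 3 - (1 + u) / √(3 + 3 * u ^ 2 + 6 * u) ^ 3

/-! ### Monotonicity of the inner attraction and the threshold -/

/-- With `p(u) = 3 + 3u² + 2bu`, the function splits as `(u / √p) * (u² (3 + bu) / p)`. The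
hypotheses `h₁` (squared) and `h₂` are the cross-multiplied comparisons of the two factors, so only
polynomial inequalities remain. -/
theorem scaledAttraction_mono {b x y : ℝ} (hx : 0 ≤ x) (hxy : x ≤ y) (hb : 0 ≤ 3 + b * x)
    (hpx : 0 < 3 + 3 * x ^ 2 + 2 * b * x) (hpy : 0 < 3 + 3 * y ^ 2 + 2 * b * y)
    (h₁ : x ^ 2 * (3 + 3 * y ^ 2 + 2 * b * y) ≤ y ^ 2 * (3 + 3 * x ^ 2 + 2 * b * x))
    (h₂ : x ^ 2 * (3 + b * x) * (3 + 3 * y ^ 2 + 2 * b * y) ≤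
      y ^ 2 * (3 + b * y) * (3 + 3 * x ^ 2 + 2 * b * x)) :
    scaledAttraction b x ≤ scaledAttraction b y := by
  have key : ∀ u : ℝ, 0 < 3 + 3 * u ^ 2 + 2 * b * u → scaledAttraction b u =
      (u / √(3 + 3 * u ^ 2 + 2 * b * u)) *
        (u ^ 2 * (3 + b * u) / (3 + 3 * u ^ 2 + 2 * b * u)) := by
    intro u hu
    have hs := Real.sq_sqrt hu.le
    have hs' := Real.sqrt_pos.2 hu
    unfold scaledAttraction
    generalize √(3 + 3 * u ^ 2 + 2 * b * u) = d at *
    rw [← hs]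
    field_simp
  have hy : 0 ≤ y := hx.trans hxy
  rw [key x hpx, key y hpy]
  refine mul_le_mul ?_ ?_ (by positivity) (div_nonneg hy (Real.sqrt_nonneg _))
  · rw [div_le_div_iff₀ (Real.sqrt_pos.2 hpx) (Real.sqrt_pos.2 hpy)]
    refine abs_le_of_sq_le_sq' ?_ (by positivity) |>.2
    rw [mul_pow, mul_pow, Real.sq_sqrt hpx.le, Real.sq_sqrt hpy.le]
    exact h₁
  · rwa [div_le_div_iff₀ hpx hpy]

theorem sqrt_three_mul_sq {x : ℝ} (hx : 0 ≤ x) : √(3 * x ^ 2) = √3 * x := by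
  rw [Real.sqrt_mul (by norm_num), Real.sqrt_sq hx]

theorem scaledAttraction_neg_three {u : ℝ} (hu : u < 1) :
    scaledAttraction (-3) u = u ^ 3 / (1 - u) ^ 2 / √3 := by
  have h : 0 < 1 - u := by linarith
  have e : 3 + 3 * u ^ 2 + 2 * (-3) * u = 3 * (1 - u) ^ 2 := by ring
  have h3 : √3 ^ 3 = 3 * √3 := by rw [pow_succ, Real.sq_sqrt (by norm_num)]
  rw [scaledAttraction, e, sqrt_three_mul_sq h.le, mul_pow, h3]
  field_simp
  ring

theorem scaledAttraction_neg_three_lt {x y : ℝ} (hx : 0 ≤ x) (hxy : x < y) (hy : y < 1) :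
    scaledAttraction (-3) x < scaledAttraction (-3) y := by
  rw [scaledAttraction_neg_three hy, scaledAttraction_neg_three (hxy.trans hy)]
  have : 0 < 1 - y := by linarith
  have : 0 < 1 - x := by linarith
  have hy0 : 0 ≤ y := hx.trans hxy.le
  gcongr ?_ / _
  calc x ^ 3 / (1 - x) ^ 2 < y ^ 3 / (1 - x) ^ 2 := by gcongr
    _ ≤ y ^ 3 / (1 - y) ^ 2 := by gcongr

theorem innerAttraction_strictMonoOn : StrictMonoOn innerAttraction (Set.Ico 0 1) := by
  rintro x ⟨hx, hx1⟩ y ⟨hy, hy1⟩ hxy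
  have hd : 0 ≤ y - x := by linarith
  have h₁ := scaledAttraction_neg_three_lt hx hxy hy1
  have hxy0 : 0 ≤ x * y := by positivity
  have h₂ : scaledAttraction (-1) x ≤ scaledAttraction (-1) y := by
    refine scaledAttraction_mono hx hxy.le (by linarith) (by nlinarith) (by nlinarith) ?_ ?_
    -- Each cross-multiplied difference is divisible by `y - x`; the other factor is the cofactor.
    -- For `b = -1` it has negative terms, controlled by `x, y < 1`.
    · have : 0 ≤ (y - x) * (3 * (x + y) - 2 * (x * y)) := mul_nonneg hd (by nlinarith)
      linarith
    · have : 0 ≤ (y - x) * (9 * (x + y) - (3 * x ^ 2 + 9 * (x * y) + 3 * y ^ 2 +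
          3 * (x * y) * (x * y)) + 2 * (x * y) * (x + y)) := by
        refine mul_nonneg hd ?_
        have hxx : x * x ≤ x * 1 := by gcongr
        have hyy : y * y ≤ y * 1 := by gcongr
        have hxy1 : x * y ≤ x * 1 := by gcongr
        have hxy2 : x * y ≤ 1 * y := by gcongr
        have : x * y * (x * y) ≤ x * y * x := by gcongr; linarith
        have : x * y * x ≤ x * 1 := by nlinarith
        have : x * y * (x * y) ≤ x * y * y := by gcongr; linarith
        nlinarith
      linarith
  have h₃ : scaledAttraction 1 x ≤ scaledAttraction 1 y := by
    refine scaledAttraction_mono hx hxy.le (by positivity) (by positivity) (by positivity) ?_ ?_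
    · have : 0 ≤ (y - x) * (3 * (x + y) + 2 * (x * y)) := by positivity
      linarith
    · have : 0 ≤ (y - x) * (9 * (x + y) + (3 * x ^ 2 + 9 * (x * y) + 3 * y ^ 2 +
          3 * (x * y) * (x * y)) + 2 * (x * y) * (x + y)) := by positivity
      linarith
  have h₄ : scaledAttraction 3 x ≤ scaledAttraction 3 y := by
    refine scaledAttraction_mono hx hxy.le (by positivity) (by positivity) (by positivity) ?_ ?_
    · have : 0 ≤ (y - x) * (3 * (x + y) + 6 * (x * y)) := by positivity
      linarith
    · have : 0 ≤ (y - x) * (9 * (x + y) + 3 * (3 * x ^ 2 + 9 * (x * y) + 3 * y ^ 2 +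
          3 * (x * y) * (x * y)) + 18 * (x * y) * (x + y)) := by positivity
      linarith
  unfold innerAttraction
  linarith

theorem scaledAttraction_continuousOn {b : ℝ} {s : Set ℝ}
    (h : ∀ u ∈ s, 0 < 3 + 3 * u ^ 2 + 2 * b * u) : ContinuousOn (scaledAttraction b) s := by
  unfold scaledAttraction
  refine ContinuousOn.div (by fun_prop) (by fun_prop) fun u hu => ?_
  have := Real.sqrt_pos.2 (h u hu)
  positivity

theorem innerAttraction_continuousOn : ContinuousOn innerAttraction (Set.Ico 0 1) := by
  unfold innerAttraction
  have h₁ : ContinuousOn (scaledAttraction (-3)) (Set.Ico 0 1) :=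
    scaledAttraction_continuousOn fun u hu => by nlinarith [hu.1, hu.2, sq_nonneg (u - 1)]
  have h₂ : ContinuousOn (scaledAttraction (-1)) (Set.Ico 0 1) :=
    scaledAttraction_continuousOn fun u hu => by nlinarith [hu.1, hu.2, sq_nonneg (u - 1)]
  have h₃ : ContinuousOn (scaledAttraction 1) (Set.Ico 0 1) :=
    scaledAttraction_continuousOn fun u hu => by have := hu.1; positivity
  have h₄ : ContinuousOn (scaledAttraction 3) (Set.Ico 0 1) :=
    scaledAttraction_continuousOn fun u hu => by have := hu.1; positivity
  fun_prop

theorem cubeSelfAttraction_eq : cubeSelfAttraction = 1 / 4 + √2 / 8 + √3 / 36 := by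
  have h4 : √4 = 2 := by
    rw [show (4 : ℝ) = 2 ^ 2 by norm_num, Real.sqrt_sq (by norm_num)]
  have h8 : √8 = 2 * √2 := by
    rw [show (8 : ℝ) = 2 ^ 2 * 2 by norm_num, Real.sqrt_mul (by norm_num),
      Real.sqrt_sq (by norm_num)]
  have h12 : √12 = 2 * √3 := by
    rw [show (12 : ℝ) = 2 ^ 2 * 3 by norm_num, Real.sqrt_mul (by norm_num),
      Real.sqrt_sq (by norm_num)]
  have h2 : √2 ^ 2 = 2 := Real.sq_sqrt (by norm_num)
  have h3 : √3 ^ 2 = 3 := Real.sq_sqrt (by norm_num)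
  have p2 : 0 < √2 := by positivity
  have p3 : 0 < √3 := by positivity
  have e2 : 4 / (2 * √2) ^ 3 = √2 / 8 := by
    rw [div_eq_div_iff (by positivity) (by norm_num)]
    linear_combination (-8 * √2 ^ 2 - 16) * h2
  have e3 : 2 / (2 * √3) ^ 3 = √3 / 36 := by
    rw [div_eq_div_iff (by positivity) (by norm_num)]
    linear_combination (-8 * √3 ^ 2 - 24) * h3
  rw [cubeSelfAttraction, h4, h8, h12, e2, e3]
  norm_num

theorem exists_innerAttraction_eq :
    ∃ δ : ℝ, 0 < δ ∧ δ < 1 ∧ innerAttraction δ = cubeSelfAttraction := by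
  have hsub : Set.Icc (0 : ℝ) (9 / 10) ⊆ Set.Ico 0 1 := fun u hu => ⟨hu.1, by linarith [hu.2]⟩
  have h0 : innerAttraction 0 = 0 := by simp [innerAttraction, scaledAttraction]
  have hA : 0 < cubeSelfAttraction := by rw [cubeSelfAttraction_eq]; positivity
  have s2 : √2 ≤ 2 := by rw [Real.sqrt_le_left (by norm_num)]; norm_num
  have s3 : √3 ≤ 2 := by rw [Real.sqrt_le_left (by norm_num)]; norm_num
  have h9 : cubeSelfAttraction ≤ innerAttraction (9 / 10) := by
    -- The term of the nearest vertex blows up as `u → 1` and alone exceeds the self-attraction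
    -- here.
    have h₁ : 12 ≤ scaledAttraction (-3) (9 / 10) := by
      rw [scaledAttraction_neg_three (by norm_num), le_div_iff₀ (by positivity)]
      norm_num
      linarith
    have h₂ : 0 ≤ scaledAttraction (-1) (9 / 10) := by
      unfold scaledAttraction
      exact div_nonneg (by norm_num) (by positivity)
    have h₃ : 0 ≤ scaledAttraction 1 (9 / 10) := by unfold scaledAttraction; positivity
    have h₄ : 0 ≤ scaledAttraction 3 (9 / 10) := by unfold scaledAttraction; positivity
    rw [cubeSelfAttraction_eq]
    unfold innerAttraction
    linarith
  obtain ⟨δ, hδ, h⟩ := intermediate_value_Icc (by norm_num : (0 : ℝ) ≤ 9 / 10)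
    (innerAttraction_continuousOn.mono hsub) ⟨h0.trans_le hA.le, h9⟩
  refine ⟨δ, lt_of_le_of_ne hδ.1 ?_, by linarith [hδ.2], h⟩
  rintro rfl
  linarith

/-! ### Positivity of the coefficient of `μ₁` -/

/-- The tangent-line bound `y ^ (-3/2) ≤ (1 / y + 1 / y ^ 2) / 2`, with `p = 3 y`. -/
theorem inv_sqrt_cube_le {p : ℝ} (hp : 0 < p) :
    1 / √p ^ 3 ≤ √3 / 3 * ((1 / p + 3 / p ^ 2) / 2) := by
  have hs := Real.sq_sqrt hp.le
  have hs' := Real.sqrt_pos.2 hp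
  have h3 : √3 ^ 2 = 3 := Real.sq_sqrt (by norm_num)
  have h3' : 0 < √3 := by positivity
  generalize √p = d at *
  generalize √3 = r at *
  rw [← hs, ← h3]
  have : r / r ^ 2 * ((1 / d ^ 2 + r ^ 2 / (d ^ 2) ^ 2) / 2) - 1 / d ^ 3 =
      (d - r) ^ 2 / (2 * r * d ^ 4) := by
    field_simp
    ring
  have : 0 ≤ (d - r) ^ 2 / (2 * r * d ^ 4) := by positivity
  linarith

/-- In units of `√3 / 3 * u`, the self-attraction contributes at least `4/5`, and the nearest and
antipodal vertices together at least `4/3`. The other six vertices cost less than `32/15 = 4/5 +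
4/3`, once the nonnegative difference `hPQ` is dropped and the tangent-line bound is applied. -/
theorem outerPull_add_pos {u : ℝ} (h0 : 0 < u) (h1 : u < 1) :
    0 < u * cubeSelfAttraction + outerPull u := by
  have hm : 0 < 1 - u := by linarith
  have h3 : √3 ^ 2 = 3 := Real.sq_sqrt (by norm_num)
  have h3' : 0 < √3 := by positivity
  have hcube : √3 ^ 3 = 3 * √3 := by rw [pow_succ, h3]
  have hA : √3 / 3 * (4 / 5) ≤ cubeSelfAttraction := by
    rw [cubeSelfAttraction_eq]
    have : 1.41 ≤ √2 := Real.le_sqrt_of_sq_le (by norm_num)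
    have : √3 ≤ 1.733 := by rw [Real.sqrt_le_left (by norm_num)]; norm_num
    linarith
  have hdiag : √3 / 3 * (4 / 3 * u) ≤
      (1 - u) / √(3 + 3 * u ^ 2 - 6 * u) ^ 3 - (1 + u) / √(3 + 3 * u ^ 2 + 6 * u) ^ 3 := by
    rw [show 3 + 3 * u ^ 2 - 6 * u = 3 * (1 - u) ^ 2 by ring,
      show 3 + 3 * u ^ 2 + 6 * u = 3 * (1 + u) ^ 2 by ring, sqrt_three_mul_sq hm.le,
      sqrt_three_mul_sq (by positivity), mul_pow, mul_pow, hcube]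
    have e : (1 - u) / (3 * √3 * (1 - u) ^ 3) - (1 + u) / (3 * √3 * (1 + u) ^ 3) =
        √3 / 3 * (4 / 3 * u) * (1 / (1 - u ^ 2) ^ 2) := by
      rw [show 1 - u ^ 2 = (1 - u) * (1 + u) by ring]
      field_simp
      rw [h3]
      ring
    rw [e]
    have hsq : 0 < 1 - u ^ 2 := by nlinarith
    refine le_mul_of_one_le_right (by positivity) ?_
    rw [le_div_iff₀ (by positivity)]
    nlinarith [sq_nonneg u]
  have hp : 0 < 3 + 3 * u ^ 2 - 2 * u := by nlinarith
  have hq : 0 < 3 + 3 * u ^ 2 + 2 * u := by positivity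
  have hP := inv_sqrt_cube_le hp
  have hQ := inv_sqrt_cube_le hq
  have hPQ : 1 / √(3 + 3 * u ^ 2 + 2 * u) ^ 3 ≤ 1 / √(3 + 3 * u ^ 2 - 2 * u) ^ 3 := by
    have := Real.sqrt_pos.2 hp
    gcongr
    linarith
  have hrat : 3 * ((1 / (3 + 3 * u ^ 2 - 2 * u) + 3 / (3 + 3 * u ^ 2 - 2 * u) ^ 2) / 2) +
      3 * ((1 / (3 + 3 * u ^ 2 + 2 * u) + 3 / (3 + 3 * u ^ 2 + 2 * u) ^ 2) / 2) < 32 / 15 := by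
    have hX : 1 / (3 + 3 * u ^ 2 - 2 * u) ≤ (1 + 2 / 3 * u - u ^ 2 / 2) / 3 := by
      rw [div_le_iff₀ hp]
      have : 0 ≤ u ^ 2 * (1 / 18 + u * (1 - u) + u ^ 2 / 2) := by positivity
      linarith
    have hY : 1 / (3 + 3 * u ^ 2 + 2 * u) ≤ (1 - 2 / 3 * u + u ^ 2 / 9) / 3 := by
      rw [div_le_iff₀ hq]
      have : 0 ≤ u ^ 2 * (2 / 27 + 16 / 27 * (1 - u) + u ^ 2 / 9) := by positivity
      linarith
    have hX2 := pow_le_pow_left₀ (by positivity) hX 2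
    have hY2 := pow_le_pow_left₀ (by positivity) hY 2
    rw [one_div_pow] at hX2 hY2
    have : 0 ≤ u ^ 3 * (1 - u) := by positivity
    have : 0 ≤ u ^ 3 := by positivity
    have : 0 ≤ u ^ 2 := by positivity
    rw [← mul_one_div 3 ((3 + 3 * u ^ 2 - 2 * u) ^ 2),
      ← mul_one_div 3 ((3 + 3 * u ^ 2 + 2 * u) ^ 2)]
    linarith
  have hrat' := mul_lt_mul_of_pos_left hrat (show 0 < √3 / 3 * u by positivity)
  have hP' := mul_le_mul_of_nonneg_left hP h0.le
  have hQ' := mul_le_mul_of_nonneg_left hQ h0.le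
  have hA' := mul_le_mul_of_nonneg_left hA h0.le
  have e₁ : (1 - 3 * u) / √(3 + 3 * u ^ 2 - 2 * u) ^ 3 =
    1 / √(3 + 3 * u ^ 2 - 2 * u) ^ 3 - 3 * (u * (1 / √(3 + 3 * u ^ 2 - 2 * u) ^ 3)) := by ring
  have e₂ : (1 + 3 * u) / √(3 + 3 * u ^ 2 + 2 * u) ^ 3 =
    1 / √(3 + 3 * u ^ 2 + 2 * u) ^ 3 + 3 * (u * (1 / √(3 + 3 * u ^ 2 + 2 * u) ^ 3)) := by ring
  unfold outerPull
  rw [e₁, e₂]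
  linarith

/-! ### Reduction to two scalar equations -/

theorem sum_sign_patterns (F : (Fin 3 → Bool) → ℝ) :
    ∑ s, F s = ∑ x : Bool, ∑ y : Bool, ∑ z : Bool, F ![x, y, z] := by
  rw [← Fintype.sum_prod_type', ← Fintype.sum_prod_type']
  refine (Fintype.sum_bijective (fun x : (Bool × Bool) × Bool => ![x.1.1, x.1.2, x.2]) ?_ _ _
    fun _ => rfl).symm
  decide

/-- The first coordinate of the total force, with law `φ` of the distance, exerted by the cube
`α • (±1, ±1, ±1)` on the point `β • (1, 1, 1)`. -/
theorem sum_cube_force (φ : ℝ → ℝ) (α β : ℝ) :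
    ∑ s, φ ‖α • cubeVertex s - β • cubeVertex fun _ => true‖ *
        (α • cubeVertex s - β • cubeVertex fun _ => true) 0 =
      φ √(3 * α ^ 2 + 3 * β ^ 2 - 6 * α * β) * (α - β) +
      φ √(3 * α ^ 2 + 3 * β ^ 2 - 2 * α * β) * (α - 3 * β) -
      φ √(3 * α ^ 2 + 3 * β ^ 2 + 2 * α * β) * (α + 3 * β) -
      φ √(3 * α ^ 2 + 3 * β ^ 2 + 6 * α * β) * (α + β) := by
  rw [sum_sign_patterns]
  simp only [Fintype.sum_bool, EuclideanSpace.norm_eq, Fin.sum_univ_three, cubeVertex,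
    PiLp.sub_apply, PiLp.smul_apply, smul_eq_mul, Real.norm_eq_abs, sq_abs,
    Matrix.cons_val_zero, Matrix.cons_val_one, Matrix.cons_val, if_true]
  simp only [Bool.false_eq_true, if_false]
  ring_nf

/-- A central configuration of nested cubes in coordinates adapted to the cubes. -/
theorem central_nestedCubes_sum {t μ₁ μ₂ : ℝ}
    {q : (Fin 3 → Bool) ⊕ (Fin 3 → Bool) → EuclideanSpace ℝ (Fin 3)}
    (hq : IsNestedCubes t q) (hc : IsCentralConfiguration q (cubeMasses μ₁ μ₂)) :
    ∃ c : ℝ, ∀ β : ℝ, β = 1 ∨ β = t →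
      μ₁ * ∑ s, (1 / ‖(1 : ℝ) • cubeVertex s - β • cubeVertex fun _ => true‖ ^ 3 - c) *
          ((1 : ℝ) • cubeVertex s - β • cubeVertex fun _ => true) 0 +
      μ₂ * ∑ s, (1 / ‖t • cubeVertex s - β • cubeVertex fun _ => true‖ ^ 3 - c) *
          (t • cubeVertex s - β • cubeVertex fun _ => true) 0 = 0 := by
  obtain ⟨p, a, R, ha, h₁, h₂⟩ := hq
  obtain ⟨c, hc⟩ := hc
  -- Scaling lengths by `a` divides `1 / r³` by `a³`, so the multiplier for unit `a` is `a³ c`.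
  refine ⟨a ^ 3 * c, fun β hβ => ?_⟩
  have hl : ∀ s, q (Sum.inl s) = p + a • R ((1 : ℝ) • cubeVertex s) := by simpa using h₁
  have hr : ∀ s, q (Sum.inr s) = p + a • R (t • cubeVertex s) := by
    intro s
    rw [h₂, h₁, map_smul, add_sub_cancel_left, smul_comm]
  obtain ⟨i, hi⟩ : ∃ i, q i = p + a • R (β • cubeVertex fun _ => true) := by
    rcases hβ with rfl | rfl
    · exact ⟨_, hl _⟩
    · exact ⟨_, hr _⟩
  have h := hc i
  -- The term `j = i` is zero because `q i - q i = 0`, so the sums may run over whole cubes.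
  rw [Finset.sum_erase _ (by simp), Fintype.sum_sum_type] at h
  have hdiff : ∀ x y : EuclideanSpace ℝ (Fin 3), (p + a • R x) - (p + a • R y) =
      a • R (x - y) := by
    intro x y
    rw [map_sub, smul_sub]
    abel
  simp only [hl, hr, hi, hdiff, cubeMasses, Sum.elim_inl, Sum.elim_inr, norm_smul,
    LinearIsometryEquiv.norm_map, Real.norm_eq_abs, abs_of_pos ha] at h
  simp only [← map_smul, ← map_sum, ← map_add] at h
  rw [← map_zero R] at h
  replace h := congrArg (fun x : EuclideanSpace ℝ (Fin 3) => a ^ 2 * x 0) (R.injective h)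
  have hterm : ∀ μ n x : ℝ, a ^ 2 * ((μ * (1 / (a * n) ^ 3 - c)) * (a * x)) =
      μ * ((1 / n ^ 3 - a ^ 3 * c) * x) := by
    intro μ n x
    rw [mul_pow, ← div_div]
    have : a ^ 3 * (1 / a ^ 3 / n ^ 3) = 1 / n ^ 3 := by
      rw [div_div, mul_one_div, div_mul_cancel_left₀ (by positivity), one_div]
    linear_combination μ * x * this
  simp only [PiLp.add_apply, PiLp.zero_apply, mul_zero, mul_add] at h
  simpa only [WithLp.ofLp_sum, Finset.sum_apply, PiLp.smul_apply, smul_eq_mul, Finset.mul_sum, hterm]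
    using h

/-- The relation between the two masses obtained from a central configuration of nested cubes by
eliminating the multiplier `c`. -/
theorem central_nestedCubes_masses {t μ₁ μ₂ : ℝ} (ht : 0 < t)
    {q : (Fin 3 → Bool) ⊕ (Fin 3 → Bool) → EuclideanSpace ℝ (Fin 3)}
    (hq : IsNestedCubes t q) (hc : IsCentralConfiguration q (cubeMasses μ₁ μ₂)) :
    t ^ 2 * (t * cubeSelfAttraction + outerPull t) * μ₁ =
      (cubeSelfAttraction - innerAttraction t) * μ₂ := by
  obtain ⟨c, hc⟩ := central_nestedCubes_sum hq hc
  have e₁ := hc 1 (Or.inl rfl)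
  have e₂ := hc t (Or.inr rfl)
  have hs : ∀ x : ℝ, √(t ^ 2 * x) = t * √x := fun x => by
    rw [Real.sqrt_mul (by positivity), Real.sqrt_sq ht.le]
  rw [sum_cube_force (fun r => 1 / r ^ 3 - c), sum_cube_force (fun r => 1 / r ^ 3 - c)] at e₁ e₂
  rw [show (3 * 1 ^ 2 + 3 * 1 ^ 2 - 2 * 1 * 1 : ℝ) = 4 by norm_num,
    show (3 * 1 ^ 2 + 3 * 1 ^ 2 + 2 * 1 * 1 : ℝ) = 8 by norm_num,
    show (3 * 1 ^ 2 + 3 * 1 ^ 2 + 6 * 1 * 1 : ℝ) = 12 by norm_num,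
    show 3 * t ^ 2 + 3 * 1 ^ 2 - 6 * t * 1 = 3 + 3 * t ^ 2 - 6 * t by ring,
    show 3 * t ^ 2 + 3 * 1 ^ 2 - 2 * t * 1 = 3 + 3 * t ^ 2 - 2 * t by ring,
    show 3 * t ^ 2 + 3 * 1 ^ 2 + 2 * t * 1 = 3 + 3 * t ^ 2 + 2 * t by ring,
    show 3 * t ^ 2 + 3 * 1 ^ 2 + 6 * t * 1 = 3 + 3 * t ^ 2 + 6 * t by ring] at e₁
  rw [show 3 * 1 ^ 2 + 3 * t ^ 2 - 6 * 1 * t = 3 + 3 * t ^ 2 - 6 * t by ring,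
    show 3 * 1 ^ 2 + 3 * t ^ 2 - 2 * 1 * t = 3 + 3 * t ^ 2 - 2 * t by ring,
    show 3 * 1 ^ 2 + 3 * t ^ 2 + 2 * 1 * t = 3 + 3 * t ^ 2 + 2 * t by ring,
    show 3 * 1 ^ 2 + 3 * t ^ 2 + 6 * 1 * t = 3 + 3 * t ^ 2 + 6 * t by ring,
    show 3 * t ^ 2 + 3 * t ^ 2 - 2 * t * t = t ^ 2 * 4 by ring,
    show 3 * t ^ 2 + 3 * t ^ 2 + 2 * t * t = t ^ 2 * 8 by ring,
    show 3 * t ^ 2 + 3 * t ^ 2 + 6 * t * t = t ^ 2 * 12 by ring,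
    hs, hs, hs, mul_pow, mul_pow, mul_pow] at e₂
  simp only [← one_div_mul_one_div] at e₂
  have hT : 1 / t ^ 3 * t ^ 3 = 1 := one_div_mul_cancel (by positivity)
  rw [innerAttraction, scaledAttraction, scaledAttraction, scaledAttraction, scaledAttraction,
    show 3 + 3 * t ^ 2 + 2 * (-3) * t = 3 + 3 * t ^ 2 - 6 * t by ring,
    show 3 + 3 * t ^ 2 + 2 * (-1) * t = 3 + 3 * t ^ 2 - 2 * t by ring,
    show 3 + 3 * t ^ 2 + 2 * 1 * t = 3 + 3 * t ^ 2 + 2 * t by ring,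
    show 3 + 3 * t ^ 2 + 2 * 3 * t = 3 + 3 * t ^ 2 + 6 * t by ring, outerPull, cubeSelfAttraction]
  -- The `c`-part of the equation at `β` is `8 c β (μ₁ + μ₂)`, so `e₂ - t * e₁` eliminates `c`; the
  -- factor `t²` clears the denominator of the inner cube's self-attraction `A / t²`.
  linear_combination t ^ 2 * e₂ - t ^ 3 * e₁ + μ₂ * (2 / √4 ^ 3 + 4 / √8 ^ 3 + 2 / √12 ^ 3) * hT

theorem mainTheorem7 :
    ∃ δ : ℝ, 0 < δ ∧ δ < 1 ∧
      ∀ (t : ℝ) (q : (Fin 3 → Bool) ⊕ (Fin 3 → Bool) → EuclideanSpace ℝ (Fin 3))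
        (μ₁ μ₂ : ℝ),
        IsNestedCubes t q →
        (μ₁ ≠ 0 ∨ μ₂ ≠ 0) →
        IsCentralConfiguration q (cubeMasses μ₁ μ₂) →
        (t ∈ Set.Ioo 0 δ → 0 < μ₁ * μ₂) ∧
        (t ∈ Set.Ioo δ 1 → μ₁ * μ₂ < 0) := by
  obtain ⟨δ, h0, h1, hδ⟩ := exists_innerAttraction_eq
  refine ⟨δ, h0, h1, fun t q μ₁ μ₂ hq hμ hc => ?_⟩
  have hrel : 0 < t → t < 1 → ∃ f : ℝ, 0 < f ∧ μ₂ ≠ 0 ∧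
      f * (μ₁ * μ₂) = (cubeSelfAttraction - innerAttraction t) * μ₂ ^ 2 := by
    intro ht ht1
    have h := central_nestedCubes_masses ht hq hc
    have hf : 0 < t ^ 2 * (t * cubeSelfAttraction + outerPull t) :=
      mul_pos (by positivity) (outerPull_add_pos ht ht1)
    refine ⟨_, hf, ?_, by linear_combination μ₂ * h⟩
    rintro rfl
    rw [mul_zero] at h
    exact hμ.elim (fun h' => h' ((mul_eq_zero.1 h).resolve_left hf.ne')) fun h' => h' rfl
  constructor
  · rintro ⟨ht, htδ⟩
    obtain ⟨f, hf, hμ₂, h⟩ := hrel ht (htδ.trans h1)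
    have hG := innerAttraction_strictMonoOn ⟨ht.le, htδ.trans h1⟩ ⟨h0.le, h1⟩ htδ
    have : 0 < f * (μ₁ * μ₂) := h ▸ mul_pos (by linarith) (by positivity)
    exact pos_of_mul_pos_right this hf.le
  · rintro ⟨hδt, ht1⟩
    have ht := h0.trans hδt
    obtain ⟨f, hf, hμ₂, h⟩ := hrel ht ht1
    have hG := innerAttraction_strictMonoOn ⟨h0.le, h1⟩ ⟨ht.le, ht1⟩ hδt
    have : f * (μ₁ * μ₂) < 0 := h ▸ mul_neg_of_neg_of_pos (by linarith) (by positivity)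
    exact (mul_neg_iff.1 this).elim (fun h' => h'.2) fun h' => absurd h'.1 hf.not_gt
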